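/- All graphs are finite and simple. An orientation of a graph $G$ replaces each edge $uv$ of $G$ by exactly one of the arcs $u\to v$, $v\to u$; it is $F$-free, for a set $F$ of oriented graphs, if it contains no member of $F$ as an induced subdigraph. Let $B_1$ and $B_2$ be the orientations $x\to y\leftarrow z$ and $x\leftarrow y\to z$ of the path on three vertices, and let $\overrightarrow{C_3}$ be the directed triangle. A graph $G$ is a proper Helly circular-arc graph if one can assign to every vertex $v$ an arc $A_v$ of a circle such that distinct vertices $u,v$ are adjacent if and only if $A_u\cap A_v\neq\varnothing$, no arc of the family is contained in another one, and the family has the Helly property: every subfamily of pairwise intersecting arcs has a common point. A connected graph $G$ admits a $\{B_1,B_2,\overrightarrow{C_3}\}$-free orientation if and only if $G$ is a proper Helly circular-arc graph. Moreover, every proper Helly circular-arc graph, connected or not, admits a $\{B_1,B_2,\overrightarrow{C_3}\}$-free orientation. -/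

import Mathlib

namespace OrientedGraphs

/-- `D` is an orientation of the simple graph `G`: every edge of `G` is replaced by exactly one
of its two possible arcs, and `D` has no other arcs (in particular, no loops). -/
structure IsOrientation {V : Type*} (G : SimpleGraph V) (D : Digraph V) : Prop where
  adj_iff : ∀ u v, G.Adj u v ↔ D.Adj u v ∨ D.Adj v u
  asymm : ∀ u v, D.Adj u v → ¬ D.Adj v u

/-- `D` contains an induced copy of the digraph `H`. -/
def HasInducedCopy {W V : Type*} (H : Digraph W) (D : Digraph V) : Prop :=
  Nonempty (H.Adj ↪r D.Adj)

/-- For a set `F` of oriented graphs of order three, `G` admits an `F`-free orientation, that is,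
an orientation that contains no member of `F` as an induced subdigraph. -/
def AdmitsFreeOrientation {V : Type*} (F : Set (Digraph (Fin 3))) (G : SimpleGraph V) : Prop :=
  ∃ D : Digraph V, IsOrientation G D ∧ ∀ H ∈ F, ¬ HasInducedCopy H D

/-- The orientation `0 → 1 ← 2` of the path on three vertices. -/
def orientedB1 : Digraph (Fin 3) where
  Adj x y := (x = 0 ∧ y = 1) ∨ (x = 2 ∧ y = 1)

/-- The orientation `0 ← 1 → 2` of the path on three vertices. -/
def orientedB2 : Digraph (Fin 3) where
  Adj x y := (x = 1 ∧ y = 0) ∨ (x = 1 ∧ y = 2)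

/-- The directed triangle `0 → 1 → 2 → 0`. -/
def directedTriangle : Digraph (Fin 3) where
  Adj x y := (x = 0 ∧ y = 1) ∨ (x = 1 ∧ y = 2) ∨ (x = 2 ∧ y = 0)

/-- A (closed) arc of the circle `ℝ / ℤ`: the set of points met when moving from `a` to `b` in the
positive direction, where the length `b - a` lies strictly between `0` and `1`. -/
def IsArc (A : Set UnitAddCircle) : Prop :=
  ∃ a b : ℝ, a < b ∧ b < a + 1 ∧ A = (fun x : ℝ => (x : UnitAddCircle)) '' Set.Icc a b

/-- The family `A` of arcs, indexed by the vertices, is an intersection model of `G`. -/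
structure IsCircularArcModel {V : Type*} (G : SimpleGraph V) (A : V → Set UnitAddCircle) :
    Prop where
  isArc : ∀ v, IsArc (A v)
  adj_iff : ∀ u v, u ≠ v → (G.Adj u v ↔ (A u ∩ A v).Nonempty)

/-- No member of the family is contained in another one. -/
def IsProperFamily {V X : Type*} (A : V → Set X) : Prop :=
  ∀ u v, u ≠ v → ¬ A u ⊆ A v

/-- The Helly property: every subfamily of pairwise intersecting sets has a common point. -/
def IsHellyFamily {V X : Type*} (A : V → Set X) : Prop :=
  ∀ S : Set V, S.Nonempty → (∀ u ∈ S, ∀ v ∈ S, (A u ∩ A v).Nonempty) →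
    (⋂ v ∈ S, A v).Nonempty

/-- `G` has a circular-arc model that is simultaneously proper and Helly. -/
def IsProperHellyCircularArc {V : Type*} (G : SimpleGraph V) : Prop :=
  ∃ A : V → Set UnitAddCircle, IsCircularArcModel G A ∧ IsProperFamily A ∧ IsHellyFamily A

end OrientedGraphs

/-!
Excluding `B₁`, `B₂` and the directed triangle means that in-neighbours of a vertex are pairwise
adjacent, out-neighbours of a vertex are pairwise adjacent, and these tournaments are transitive.

*From a model to an orientation.* In a proper family, two arcs meet if and only if one of them
contains the initial point of the other. If this never happens in both directions, each edge
`uv` is oriented as `u → v` when the arc of `u` contains the initial point of the arc of `v`. Then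
the arcs of the in-neighbours of `v` share the initial point of `v`, those of its out-neighbours
share, by properness, its final point, and a directed triangle is impossible: by the Helly property
its three arcs have a common point, and seen from that point the initial points would increase
cyclically (`IsLiftedModel.exists_isLocallyTransitive_of_not_hits`). If two arcs do contain each
other's initial points, they cover the circle, and by properness both vertices are universal.
Cutting the circle inside the arc of a universal vertex turns the model into a linear order of the
vertices without umbrellas, along which all edges are oriented
(`IsLiftedModel.exists_isLocallyTransitive_of_universal`).

*From an orientation to a model.* Every vertex with out-neighbours has a first one, the source of
the transitive tournament they form. The map to the first out-neighbour is injective, so it extends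
to a permutation `σ`, and the heads of the arcs of `v` are `σ v, …, (σ ^ d) v` for some `d`. Every edge
lies within a cycle of `σ`; by connectedness `σ` is a single cycle, and the vertices are arranged
around the circle so that every vertex dominates the `d` vertices following it
(`IsLocallyTransitive.exists_isRound`). The arc from the position of `v` to just after the position
of its last out-neighbour contains precisely the positions of `v` and its out-neighbours. Ending the
arcs slightly apart makes the family proper. A clique is a transitive tournament, and all its arcs
contain the position of its sink, which is the Helly property
(`IsRound.isProperHellyCircularArc`).
-/

namespace OrientedGraphs

open Set

/-! ### Orientations without induced `B₁`, `B₂` and directed triangles -/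

/-- A locally transitive oriented graph: in-neighbours of a vertex are pairwise adjacent, and so
are its out-neighbours, and there is no directed triangle. Without directed triangles, the
neighbourhoods in question are transitive tournaments. -/
structure IsLocallyTransitive {V : Type*} (D : Digraph V) : Prop where
  asymm : ∀ u v, D.Adj u v → ¬ D.Adj v u
  inAdj : ∀ u v w, D.Adj u v → D.Adj w v → u ≠ w → D.Adj u w ∨ D.Adj w u
  outAdj : ∀ u v w, D.Adj v u → D.Adj v w → u ≠ w → D.Adj u w ∨ D.Adj w u
  noTriangle : ∀ u v w, D.Adj u v → D.Adj v w → ¬ D.Adj w u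

/-- Three distinct vertices on which `D` has the same arcs as `H` form an induced copy of `H`. -/
lemma hasInducedCopy_of_triple {V : Type*} {D : Digraph V} {H : Digraph (Fin 3)} (x : Fin 3 → V)
    (h01 : x 0 ≠ x 1) (h02 : x 0 ≠ x 2) (h12 : x 1 ≠ x 2)
    (h : ∀ i j, D.Adj (x i) (x j) ↔ H.Adj i j) : HasInducedCopy H D := by
  refine ⟨⟨⟨x, ?_⟩, fun {i j} => h i j⟩⟩
  intro i j hij
  fin_cases i <;> fin_cases j <;> simp_all

lemma isLocallyTransitive_iff {V : Type*} {G : SimpleGraph V} {D : Digraph V}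
    (hD : IsOrientation G D) :
    IsLocallyTransitive D ↔
      ∀ H ∈ ({orientedB1, orientedB2, directedTriangle} : Set (Digraph (Fin 3))),
        ¬ HasInducedCopy H D := by
  have has := hD.asymm
  have hirr : ∀ u, ¬ D.Adj u u := fun u h => has u u h h
  constructor
  · rintro h H hH ⟨f⟩
    have key : ∀ i j, D.Adj (f i) (f j) ↔ H.Adj i j := fun i j => f.map_rel_iff
    have hne : f 0 ≠ f 2 := fun e => by simpa using f.injective e
    rcases hH with rfl | rfl | rfl
    · have h1 : D.Adj (f 0) (f 1) := (key _ _).2 (by simp [orientedB1])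
      have h2 : D.Adj (f 2) (f 1) := (key _ _).2 (by simp [orientedB1])
      rcases h.inAdj _ _ _ h1 h2 hne with h3 | h3 <;>
        simpa [orientedB1] using (key _ _).1 h3
    · have h1 : D.Adj (f 1) (f 0) := (key _ _).2 (by simp [orientedB2])
      have h2 : D.Adj (f 1) (f 2) := (key _ _).2 (by simp [orientedB2])
      rcases h.outAdj _ _ _ h1 h2 hne with h3 | h3 <;>
        simpa [orientedB2] using (key _ _).1 h3
    · exact h.noTriangle (f 0) (f 1) (f 2) ((key _ _).2 (by simp [directedTriangle]))
        ((key _ _).2 (by simp [directedTriangle])) ((key _ _).2 (by simp [directedTriangle]))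
  · intro h
    have hne : ∀ {u v}, D.Adj u v → u ≠ v := by
      rintro u v huv rfl
      exact hirr _ huv
    refine ⟨has, fun u v w h1 h2 huw => ?_, fun u v w h1 h2 huw => ?_, fun u v w h1 h2 h3 => ?_⟩
    · by_contra! hn
      refine h orientedB1 (by simp)
        (hasInducedCopy_of_triple ![u, v, w] (hne h1) huw (hne h2).symm ?_)
      intro i j
      fin_cases i <;> fin_cases j <;> simp [orientedB1, hirr, h1, h2, hn, has _ _ h1, has _ _ h2]
    · by_contra! hn
      refine h orientedB2 (by simp)
        (hasInducedCopy_of_triple ![u, v, w] (hne h1).symm huw (hne h2) ?_)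
      intro i j
      fin_cases i <;> fin_cases j <;> simp [orientedB2, hirr, h1, h2, hn, has _ _ h1, has _ _ h2]
    · refine h directedTriangle (by simp)
        (hasInducedCopy_of_triple ![u, v, w] (hne h1) (hne h3).symm (hne h2) ?_)
      intro i j
      fin_cases i <;> fin_cases j <;>
        simp [directedTriangle, hirr, h1, h2, h3, has _ _ h1, has _ _ h2, has _ _ h3]

lemma admitsFreeOrientation_iff {V : Type*} {G : SimpleGraph V} :
    AdmitsFreeOrientation {orientedB1, orientedB2, directedTriangle} G ↔
      ∃ D : Digraph V, IsOrientation G D ∧ IsLocallyTransitive D :=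
  exists_congr fun _ => and_congr_right fun hD => (isLocallyTransitive_iff hD).symm

/-- Orienting every edge upwards along a linear order without umbrellas (the order type of a
proper interval graph) gives a locally transitive orientation. -/
lemma exists_isLocallyTransitive_of_order {V α : Type*} [LinearOrder α] {G : SimpleGraph V}
    (k : V → α) (hk : Function.Injective k)
    (h : ∀ u v w, k u < k v → k v < k w → G.Adj u w → G.Adj u v ∧ G.Adj v w) :
    ∃ D : Digraph V, IsOrientation G D ∧ IsLocallyTransitive D := by
  refine ⟨⟨fun u v => G.Adj u v ∧ k u < k v⟩, ⟨fun u v => ?_, fun u v h1 h2 => ?_⟩,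
    ⟨fun u v h1 h2 => ?_, ?_, ?_, ?_⟩⟩
  · constructor
    · intro huv
      rcases lt_or_gt_of_ne (hk.ne huv.ne) with h1 | h1
      · exact Or.inl ⟨huv, h1⟩
      · exact Or.inr ⟨huv.symm, h1⟩
    · rintro (h1 | h1)
      · exact h1.1
      · exact h1.1.symm
  · exact lt_asymm h1.2 h2.2
  · exact lt_asymm h1.2 h2.2
  · rintro u v w ⟨h1, h1'⟩ ⟨h2, h2'⟩ hne
    rcases lt_or_gt_of_ne (hk.ne hne) with h3 | h3
    · exact Or.inl ⟨(h u w v h3 h2' h1).1, h3⟩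
    · exact Or.inr ⟨(h w u v h3 h1' h2).1, h3⟩
  · rintro u v w ⟨h1, h1'⟩ ⟨h2, h2'⟩ hne
    rcases lt_or_gt_of_ne (hk.ne hne) with h3 | h3
    · exact Or.inl ⟨(h v u w h1' h3 h2).2, h3⟩
    · exact Or.inr ⟨(h v w u h2' h3 h1).2, h3⟩
  · rintro u v w ⟨-, h1⟩ ⟨-, h2⟩ ⟨-, h3⟩
    exact lt_asymm (h1.trans h2) h3

/-! ### Arcs of the circle and their lifts to the line -/

/-- The arc of `ℝ / ℤ` met when moving from `a` to `b` in the positive direction. -/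
def arc (a b : ℝ) : Set UnitAddCircle := (fun x : ℝ => (x : UnitAddCircle)) '' Icc a b

lemma coe_eq_coe_iff {x y : ℝ} : (x : UnitAddCircle) = y ↔ ∃ m : ℤ, x = y + m := by
  rw [← sub_eq_zero, ← AddCircle.coe_sub, AddCircle.coe_eq_zero_iff]
  refine exists_congr fun m => ?_
  rw [zsmul_one]
  constructor <;> intro h <;> linarith

lemma coe_add_int (x : ℝ) (m : ℤ) : ((x + m : ℝ) : UnitAddCircle) = x :=
  coe_eq_coe_iff.2 ⟨m, rfl⟩

lemma coe_mem_arc {a b x : ℝ} : (x : UnitAddCircle) ∈ arc a b ↔ ∃ m : ℤ, a ≤ x + m ∧ x + m ≤ b := by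
  constructor
  · rintro ⟨y, hy, hyx⟩
    obtain ⟨m, rfl⟩ := coe_eq_coe_iff.1 hyx
    exact ⟨m, hy⟩
  · rintro ⟨m, hm⟩
    exact ⟨x + m, hm, coe_add_int x m⟩

lemma coe_mem_arc_of_mem {a b x : ℝ} (h₁ : a ≤ x) (h₂ : x ≤ b) : (x : UnitAddCircle) ∈ arc a b :=
  ⟨x, ⟨h₁, h₂⟩, rfl⟩

lemma arc_subset_arc {a b c d : ℝ} (h₁ : c ≤ a) (h₂ : b ≤ d) : arc a b ⊆ arc c d :=
  image_mono (Icc_subset_Icc h₁ h₂)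

lemma arc_add_int (a b : ℝ) (m : ℤ) : arc (a + m) (b + m) = arc a b := by
  ext x
  obtain ⟨x, rfl⟩ := QuotientAddGroup.mk_surjective x
  change (x : UnitAddCircle) ∈ _ ↔ (x : UnitAddCircle) ∈ _
  rw [coe_mem_arc, coe_mem_arc]
  constructor
  · rintro ⟨k, h1, h2⟩
    refine ⟨k - m, ?_, ?_⟩ <;> push_cast <;> linarith
  · rintro ⟨k, h1, h2⟩
    refine ⟨k + m, ?_, ?_⟩ <;> push_cast <;> linarith

/-- Two intersecting arcs are such that one of them contains the initial point of the other. -/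
lemma start_mem_or_of_inter {a b c d : ℝ} (h : (arc a b ∩ arc c d).Nonempty) :
    (a : UnitAddCircle) ∈ arc c d ∨ (c : UnitAddCircle) ∈ arc a b := by
  obtain ⟨_, ⟨x, hx, rfl⟩, hx'⟩ := h
  obtain ⟨m, h1, h2⟩ := coe_mem_arc.1 hx'
  rcases le_total c (a + m) with h | h
  · exact Or.inl (coe_mem_arc.2 ⟨m, h, by linarith [hx.1]⟩)
  · refine Or.inr (coe_mem_arc.2 ⟨-m, ?_, ?_⟩) <;> push_cast <;> linarith [hx.1, hx.2]

/-- Points just after the end of the second arc belong to the first arc only. -/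
lemma not_arc_subset_arc {a b c d : ℝ} (h₁ : a ≤ d) (h₂ : d < b)
    (hcd : d < c + 1) : ¬ arc a b ⊆ arc c d := by
  intro h
  obtain ⟨x, hx1, hx2⟩ := exists_between (lt_min h₂ hcd)
  rw [lt_min_iff] at hx2
  obtain ⟨m, h4, h5⟩ := coe_mem_arc.1 (h (coe_mem_arc_of_mem (h₁.trans hx1.le) hx2.1.le))
  have h6 : (m : ℝ) < 0 := by linarith
  have h7 : (-1 : ℝ) < m := by linarith
  have h8 : m < 0 := by exact_mod_cast h6
  have h9 : -1 < m := by exact_mod_cast h7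
  omega

/-! ### From a proper Helly circular-arc model to an orientation -/

/-- A circular-arc model of `G`, with the endpoints of the arcs lifted to the line, that is proper
and Helly. -/
structure IsLiftedModel {V : Type*} (G : SimpleGraph V) (a b : V → ℝ) : Prop where
  lt : ∀ v, a v < b v
  lt_add_one : ∀ v, b v < a v + 1
  adj_iff : ∀ u v, u ≠ v → (G.Adj u v ↔ (arc (a u) (b u) ∩ arc (a v) (b v)).Nonempty)
  proper : IsProperFamily fun v => arc (a v) (b v)
  helly : IsHellyFamily fun v => arc (a v) (b v)

lemma IsProperHellyCircularArc.exists_isLiftedModel {V : Type*} {G : SimpleGraph V}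
    (h : IsProperHellyCircularArc G) : ∃ a b : V → ℝ, IsLiftedModel G a b := by
  obtain ⟨A, hA, hp, hh⟩ := h
  choose a b h1 h2 h3 using hA.isArc
  have : A = fun v => arc (a v) (b v) := funext h3
  subst this
  exact ⟨a, b, h1, h2, hA.adj_iff, hp, hh⟩

namespace IsLiftedModel

variable {V : Type*} {G : SimpleGraph V} {a b : V → ℝ}

/-- The arc of `u` contains the initial point of the arc of `v`. -/
def Hits (a b : V → ℝ) (u v : V) : Prop := (a v : UnitAddCircle) ∈ arc (a u) (b u)

lemma hits_self (h : IsLiftedModel G a b) (u : V) : Hits a b u u :=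
  coe_mem_arc_of_mem le_rfl (h.lt u).le

lemma inter_of_hits (h : IsLiftedModel G a b) {u v : V} (huv : Hits a b u v) :
    (arc (a u) (b u) ∩ arc (a v) (b v)).Nonempty :=
  ⟨_, huv, h.hits_self v⟩

lemma adj_of_hits (h : IsLiftedModel G a b) {u v : V} (hne : u ≠ v) (huv : Hits a b u v) :
    G.Adj u v :=
  (h.adj_iff u v hne).2 (h.inter_of_hits huv)

lemma adj_iff_hits (h : IsLiftedModel G a b) {u v : V} (hne : u ≠ v) :
    G.Adj u v ↔ Hits a b u v ∨ Hits a b v u := by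
  constructor
  · intro h1
    exact (start_mem_or_of_inter ((h.adj_iff u v hne).1 h1)).symm
  · rintro (h1 | h1)
    · exact h.adj_of_hits hne h1
    · exact (h.adj_of_hits hne.symm h1).symm

/-- By properness, arcs end in the order in which they start. -/
lemma end_lt (h : IsLiftedModel G a b) {u v : V} (hne : u ≠ v) (m : ℤ) (h₁ : a u ≤ a v + m) :
    b u < b v + m := by
  by_contra! h2
  have h3 := arc_subset_arc h₁ h2
  rw [arc_add_int] at h3
  exact h.proper v u hne.symm h3

/-- If each of two arcs contains the initial point of the other, then they cover the circle; an
arc disjoint from one of them would be contained in the other one. -/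
lemma adj_of_hits_hits (h : IsLiftedModel G a b) {u v w : V} (huv : u ≠ v) (h₁ : Hits a b u v)
    (h₂ : Hits a b v u) (hw : u ≠ w) : G.Adj u w := by
  rcases eq_or_ne v w with rfl | hvw
  · exact h.adj_of_hits huv h₁
  obtain ⟨m, h3, h4⟩ := coe_mem_arc.1 h₁
  obtain ⟨k, h5, h6⟩ := coe_mem_arc.1 h₂
  have h7 := h.end_lt huv m h3
  have h8 := h.end_lt huv.symm k h5
  -- The lifts wind around the circle: after one turn, the arc of `v` reaches the start of `u`.
  have h9 : (1 : ℝ) ≤ k + m := by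
    have : (0 : ℝ) < k + m := by linarith
    exact_mod_cast (by exact_mod_cast this : (0 : ℤ) < k + m)
  by_contra hn
  set j : ℤ := -⌊a w - a u⌋ with hj
  have h10 : a u ≤ a w + j := by
    rw [hj]; push_cast; linarith [Int.floor_le (a w - a u)]
  have h11 : a w + j < a u + 1 := by
    rw [hj]; push_cast; linarith [Int.lt_floor_add_one (a w - a u)]
  have h12 : b u < a w + j := by
    by_contra! h12
    exact hn (h.adj_of_hits hw (coe_mem_arc.2 ⟨j, h10, h12⟩))
  have h13 : b w + j < a u + 1 := by
    by_contra! h13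
    refine hn (h.adj_of_hits hw.symm (coe_mem_arc.2 ⟨1 - j, ?_, ?_⟩)).symm <;> push_cast <;>
      linarith
  have h14 := h.end_lt hvw (j - m) (by push_cast; linarith)
  push_cast at h14
  linarith

/-- If no two arcs contain each other's initial points, the edges are oriented towards the arc
whose initial point is covered. -/
lemma exists_isLocallyTransitive_of_not_hits (h : IsLiftedModel G a b)
    (hn : ∀ u v, u ≠ v → Hits a b u v → ¬ Hits a b v u) :
    ∃ D : Digraph V, IsOrientation G D ∧ IsLocallyTransitive D := by
  refine ⟨⟨fun u v => u ≠ v ∧ Hits a b u v⟩, ⟨fun u v => ?_, fun u v h1 h2 => ?_⟩,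
    ⟨fun u v h1 h2 => ?_, ?_, ?_, ?_⟩⟩
  · rcases eq_or_ne u v with rfl | hne
    · simp
    · simp [h.adj_iff_hits hne, hne, hne.symm]
  · exact hn _ _ h1.1 h1.2 h2.2
  · exact hn _ _ h1.1 h1.2 h2.2
  · rintro u v w ⟨-, h1⟩ ⟨-, h2⟩ hne
    rcases start_mem_or_of_inter ⟨_, h1, h2⟩ with h3 | h3
    · exact Or.inr ⟨hne.symm, h3⟩
    · exact Or.inl ⟨hne, h3⟩
  · rintro u v w ⟨h1', h1⟩ ⟨h2', h2⟩ hne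
    obtain ⟨m, h3, h4⟩ := coe_mem_arc.1 h1
    obtain ⟨k, h5, h6⟩ := coe_mem_arc.1 h2
    -- By properness, the arcs of `u` and `w` both contain the final point of the arc of `v`.
    have h7 := h.end_lt h1' m h3
    have h8 := h.end_lt h2' k h5
    have h9 : ((b v : ℝ) : UnitAddCircle) ∈ arc (a u) (b u) := by
      rw [← arc_add_int _ _ m]; exact coe_mem_arc_of_mem h4 h7.le
    have h10 : ((b v : ℝ) : UnitAddCircle) ∈ arc (a w) (b w) := by
      rw [← arc_add_int _ _ k]; exact coe_mem_arc_of_mem h6 h8.le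
    rcases start_mem_or_of_inter ⟨_, h9, h10⟩ with h3 | h3
    · exact Or.inr ⟨hne.symm, h3⟩
    · exact Or.inl ⟨hne, h3⟩
  · rintro u v w ⟨h1', h1⟩ ⟨h2', h2⟩ ⟨h3', h3⟩
    have i1 := h.inter_of_hits h1
    have i2 := h.inter_of_hits h2
    have i3 := h.inter_of_hits h3
    have self : ∀ x, (arc (a x) (b x) ∩ arc (a x) (b x)).Nonempty :=
      fun x => h.inter_of_hits (h.hits_self x)
    obtain ⟨p, hp⟩ := h.helly {u, v, w} ⟨u, by simp⟩ (by
      have i1' := inter_comm _ _ ▸ i1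
      have i2' := inter_comm _ _ ▸ i2
      have i3' := inter_comm _ _ ▸ i3
      rintro x (rfl | rfl | rfl) y (rfl | rfl | rfl) <;> first | exact self _ | assumption)
    obtain ⟨p, rfl⟩ := QuotientAddGroup.mk_surjective p
    simp only [mem_iInter] at hp
    obtain ⟨i, hi, hi'⟩ := coe_mem_arc.1 (hp u (by simp))
    obtain ⟨j, hj, hj'⟩ := coe_mem_arc.1 (hp v (by simp))
    obtain ⟨k, hk, hk'⟩ := coe_mem_arc.1 (hp w (by simp))
    -- Seen from the common point, each arc of the triangle goes from an earlier to a later start.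
    have aux : ∀ {x y : V} {i j : ℤ}, x ≠ y → Hits a b x y → a x ≤ p + i → p + j ≤ b y →
        a x - i < a y - j := by
      intro x y i j hxy hh hx hy
      by_contra! hc
      refine hn x y hxy hh (coe_mem_arc.2 ⟨j - i, ?_, ?_⟩) <;> push_cast <;> linarith
    have l1 := aux h1' h1 hi hj'
    have l2 := aux h2' h2 hj hk'
    have l3 := aux h3' h3 hk hi'
    linarith

/-- If the arc of `x` meets all other arcs, then cutting the circle inside it yields a linear order
without umbrellas: first the arcs through the initial point of `x` that do not wind around the
circle with `x`, then those that do (`x` included), then the arcs that start inside the arc of `x`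
after its initial point. -/
lemma exists_isLocallyTransitive_of_universal (h : IsLiftedModel G a b) (x : V)
    (hx : ∀ v, x ≠ v → G.Adj x v) :
    ∃ D : Digraph V, IsOrientation G D ∧ IsLocallyTransitive D := by
  classical
  -- Lift every arc anew, so that it meets the chosen lift of the arc of `x`.
  have hlift : ∀ v, ∃ m : ℤ, (Hits a b v x → a v + m ≤ a x ∧ a x ≤ b v + m) ∧
      (¬ Hits a b v x → a x ≤ a v + m ∧ a v + m ≤ b x) := by
    intro v
    by_cases hv : Hits a b v x
    · obtain ⟨m, h1, h2⟩ := coe_mem_arc.1 hv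
      refine ⟨-m, fun _ => ⟨?_, ?_⟩, fun hc => absurd hv hc⟩ <;> push_cast <;> linarith
    · have hne : x ≠ v := by
        rintro rfl
        exact hv (h.hits_self x)
      obtain ⟨m, h1, h2⟩ :=
        coe_mem_arc.1 (((h.adj_iff_hits hne).1 (hx v hne)).resolve_right hv)
      exact ⟨m, fun hc => absurd hc hv, fun _ => ⟨h1, h2⟩⟩
  choose m hL hR using hlift
  set s : V → ℝ := fun v => a v + m v with hs
  set t : V → ℝ := fun v => b v + m v with ht
  have hmem : ∀ {p : ℝ} {v : V}, s v ≤ p → p ≤ t v → (p : UnitAddCircle) ∈ arc (a v) (b v) := by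
    intro p v h1 h2
    rw [← arc_add_int _ _ (m v)]
    exact coe_mem_arc_of_mem h1 h2
  have hadj : ∀ {u v : V} (p : ℝ), u ≠ v → (p : UnitAddCircle) ∈ arc (a u) (b u) →
      (p : UnitAddCircle) ∈ arc (a v) (b v) → G.Adj u v :=
    fun p hne h1 h2 => (h.adj_iff _ _ hne).2 ⟨_, h1, h2⟩
  have hend : ∀ {u v : V}, u ≠ v → s u ≤ s v → t u < t v := by
    intro u v hne huv
    have := h.end_lt hne (m v - m u) (by push_cast; simp only [hs] at huv; linarith)
    push_cast at this
    simp only [ht]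
    linarith
  have hsinj : Function.Injective s := by
    intro u v huv
    by_contra hne
    exact lt_asymm (hend hne huv.le) (hend (Ne.symm hne) huv.ge)
  set c : V → ℕ := fun v => if Hits a b v x then (if Hits a b x v then 1 else 0) else 2 with hc
  have hc0 : ∀ {v}, c v = 0 → Hits a b v x ∧ ¬ Hits a b x v := by
    intro v; simp only [hc]; split_ifs <;> simp_all
  have hc1 : ∀ {v w}, c v = 1 → v ≠ w → G.Adj v w := by
    intro v w hv hvw
    rcases eq_or_ne x v with rfl | hxv
    · exact hx w hvw
    · have : Hits a b v x ∧ Hits a b x v := by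
        revert hv; simp only [hc]; split_ifs <;> simp_all
      exact h.adj_of_hits_hits hxv.symm this.1 this.2 hvw
  have hc2 : ∀ {v}, c v = 2 → ¬ Hits a b v x := by
    intro v; simp only [hc]; split_ifs <;> simp_all
  have hcle : ∀ v, c v ≤ 2 := by
    intro v; simp only [hc]; split_ifs <;> simp
  -- Arcs of the first class contain the initial point of `x`, those of the last its final point.
  have hax : ∀ {v}, c v = 0 → (a x : UnitAddCircle) ∈ arc (a v) (b v) := fun hv => (hc0 hv).1
  have hbt : ∀ {v}, c v = 2 → a x ≤ s v ∧ s v ≤ b x ∧ b x < t v := by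
    intro v hv
    have hn := hc2 hv
    have hne : x ≠ v := by
      rintro rfl
      exact hn (h.hits_self x)
    exact ⟨(hR v hn).1, (hR v hn).2, h.end_lt hne (m v) (hR v hn).1⟩
  have hbx : ∀ {v}, c v = 2 → (b x : UnitAddCircle) ∈ arc (a v) (b v) :=
    fun hv => hmem (hbt hv).2.1 (hbt hv).2.2.le
  -- By the Helly property, intersecting arcs of the first and last class meet inside the arc of `x`.
  have hmeet : ∀ {u w}, c u = 0 → c w = 2 → G.Adj u w →
      ∃ p, a x ≤ p ∧ p ≤ b x ∧ p ≤ t u ∧ s w ≤ p := by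
    intro u w hu hw huw
    have hxu : x ≠ u := by
      rintro rfl
      exact (hc0 hu).2 (h.hits_self _)
    have hxw : x ≠ w := by
      rintro rfl
      exact hc2 hw (h.hits_self _)
    have i1 := (h.adj_iff _ _ hxu).1 (hx u hxu)
    have i2 := (h.adj_iff _ _ hxw).1 (hx w hxw)
    have i3 := (h.adj_iff _ _ huw.ne).1 huw
    have self : ∀ y, (arc (a y) (b y) ∩ arc (a y) (b y)).Nonempty :=
      fun y => h.inter_of_hits (h.hits_self y)
    obtain ⟨q, hq⟩ := h.helly {x, u, w} ⟨u, by simp⟩ (by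
      have i1' := inter_comm _ _ ▸ i1
      have i2' := inter_comm _ _ ▸ i2
      have i3' := inter_comm _ _ ▸ i3
      rintro y (rfl | rfl | rfl) z (rfl | rfl | rfl) <;> first | exact self _ | assumption)
    simp only [mem_iInter] at hq
    obtain ⟨p, ⟨hp, hp'⟩, rfl⟩ := hq x (by simp)
    obtain ⟨i, hi, hi'⟩ := coe_mem_arc.1
      ((arc_add_int (a u) (b u) (m u)).symm ▸ hq u (by simp))
    obtain ⟨j, hj, hj'⟩ := coe_mem_arc.1
      ((arc_add_int (a w) (b w) (m w)).symm ▸ hq w (by simp))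
    have hu' := hL u (hc0 hu).1
    have hw' := hbt hw
    have hlu := h.lt_add_one u
    have hlx := h.lt_add_one x
    simp only [hs, ht] at hu' hw' ⊢
    refine ⟨p, hp, hp', ?_, ?_⟩
    · by_contra! hlt
      have hi0 : i ≤ -1 := by
        by_contra! hc
        have : (0 : ℝ) ≤ i := by exact_mod_cast (by omega : 0 ≤ i)
        linarith
      have hi0' : (i : ℝ) ≤ -1 := by exact_mod_cast hi0
      refine (hc0 hu).2 (coe_mem_arc.2 ⟨m u + 1, ?_, ?_⟩) <;> push_cast <;> linarith
    · by_contra! hlt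
      have hj0 : 1 ≤ j := by
        by_contra! hc
        have : (j : ℝ) ≤ 0 := by exact_mod_cast (by omega : j ≤ 0)
        linarith
      have hj0' : (1 : ℝ) ≤ j := by exact_mod_cast hj0
      refine hc2 hw (coe_mem_arc.2 ⟨1 - m w, ?_, ?_⟩) <;> push_cast <;> linarith
  have hlex : ∀ {u v}, toLex (c u, s u) < toLex (c v, s v) ↔ c u < c v ∨ c u = c v ∧ s u < s v :=
    fun {u v} => Prod.Lex.toLex_lt_toLex
  refine exists_isLocallyTransitive_of_order (fun v => toLex (c v, s v)) ?_ ?_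
  · intro u v huv
    exact hsinj (congrArg Prod.snd (toLex.injective huv))
  · intro u v w huv hvw huw
    have huv' : u ≠ v := by rintro rfl; exact lt_irrefl _ huv
    have hvw' : v ≠ w := by rintro rfl; exact lt_irrefl _ hvw
    rw [hlex] at huv hvw
    have u2 := hcle u
    have v2 := hcle v
    have w2 := hcle w
    by_cases hv1 : c v = 1
    · exact ⟨(hc1 hv1 huv'.symm).symm, hc1 hv1 hvw'⟩
    by_cases hu1 : c u = 1
    · have hv : c v = 2 := by omega
      have hw : c w = 2 := by omega
      exact ⟨hc1 hu1 huv', hadj _ hvw' (hbx hv) (hbx hw)⟩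
    by_cases hw1 : c w = 1
    · have hv : c v = 0 := by omega
      have hu : c u = 0 := by omega
      exact ⟨hadj _ huv' (hax hu) (hax hv), (hc1 hw1 hvw'.symm).symm⟩
    by_cases hw0 : c w = 0
    · have hv : c v = 0 := by omega
      have hu : c u = 0 := by omega
      exact ⟨hadj _ huv' (hax hu) (hax hv), hadj _ hvw' (hax hv) (hax hw0)⟩
    by_cases hu2 : c u = 2
    · have hv : c v = 2 := by omega
      have hw : c w = 2 := by omega
      exact ⟨hadj _ huv' (hbx hu2) (hbx hv), hadj _ hvw' (hbx hv) (hbx hw)⟩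
    have hu : c u = 0 := by omega
    have hw : c w = 2 := by omega
    obtain ⟨p, p1, p2, p3, p4⟩ := hmeet hu hw huw
    by_cases hv0 : c v = 0
    · have hsv : s u < s v := (huv.resolve_left (by omega)).2
      exact ⟨hadj _ huv' (hax hu) (hax hv0), hadj p hvw'
        (hmem ((hL v (hc0 hv0).1).1.trans p1) (p3.trans (hend huv' hsv.le).le))
        (hmem p4 (p2.trans (hbt hw).2.2.le))⟩
    · have hv : c v = 2 := by omega
      have hsv : s v < s w := (hvw.resolve_left (by omega)).2
      exact ⟨hadj p huv' (hmem ((hL u (hc0 hu).1).1.trans p1) p3)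
        (hmem (hsv.le.trans p4) (p2.trans (hbt hv).2.2.le)), hadj _ hvw' (hbx hv) (hbx hw)⟩

end IsLiftedModel

theorem IsProperHellyCircularArc.exists_isLocallyTransitive {V : Type*} {G : SimpleGraph V}
    (hG : IsProperHellyCircularArc G) :
    ∃ D : Digraph V, IsOrientation G D ∧ IsLocallyTransitive D := by
  obtain ⟨a, b, h⟩ := hG.exists_isLiftedModel
  by_cases hn : ∀ u v, u ≠ v → IsLiftedModel.Hits a b u v → ¬ IsLiftedModel.Hits a b v u
  · exact h.exists_isLocallyTransitive_of_not_hits hn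
  · push Not at hn
    obtain ⟨u, v, huv, h1, h2⟩ := hn
    exact h.exists_isLocallyTransitive_of_universal u fun w => h.adj_of_hits_hits huv h1 h2

/-! ### The round order of a connected locally transitive orientation -/

namespace IsLocallyTransitive

variable {V : Type*} {D : Digraph V}

lemma reverse (hD : IsLocallyTransitive D) : IsLocallyTransitive ⟨fun u v => D.Adj v u⟩ :=
  ⟨fun u v => hD.asymm v u, fun u v w h1 h2 hne => (hD.outAdj u v w h1 h2 hne).symm,
    fun u v w h1 h2 hne => (hD.inAdj u v w h1 h2 hne).symm,
    fun u v w h1 h2 h3 => hD.noTriangle w v u h2 h1 h3⟩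

variable [Finite V]

/-- Pairwise adjacent vertices induce a transitive tournament, which has a sink. -/
lemma exists_sink (hD : IsLocallyTransitive D) {S : Set V} (hS : S.Nonempty)
    (h : ∀ u ∈ S, ∀ v ∈ S, u ≠ v → D.Adj u v ∨ D.Adj v u) :
    ∃ v ∈ S, ∀ u ∈ S, u ≠ v → D.Adj u v := by
  let r : S → S → Prop := fun u v => D.Adj v u
  have : IsTrans S r := ⟨by
    rintro ⟨u, hu⟩ ⟨v, hv⟩ ⟨w, hw⟩ h1 h2
    have hne : w ≠ u := by
      rintro rfl
      exact hD.asymm _ _ h1 h2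
    exact (h w hw u hu hne).resolve_right fun h3 => hD.noTriangle _ _ _ h3 h2 h1⟩
  have : Std.Irrefl r := ⟨fun u h => hD.asymm _ _ h h⟩
  obtain ⟨v, -, hv⟩ := (Finite.wellFounded_of_trans_of_irrefl r).has_min univ
    ⟨⟨_, hS.some_mem⟩, trivial⟩
  exact ⟨v, v.2, fun u hu hne => (h u hu v v.2 hne).resolve_right (hv ⟨u, hu⟩ trivial)⟩

/-- Every vertex with an out-neighbour has a first out-neighbour: the source of the transitive
tournament induced by its out-neighbours. -/
lemma exists_first (hD : IsLocallyTransitive D) {v : V} (hv : ∃ w, D.Adj v w) :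
    ∃ s, D.Adj v s ∧ ∀ w, D.Adj v w → w ≠ s → D.Adj s w :=
  hD.reverse.exists_sink (S := {w | D.Adj v w}) hv
    fun _ hu _ hw hne => (hD.outAdj _ _ _ hu hw hne).symm

/-- Sending a vertex to its first out-neighbour is injective, and hence it extends to a
permutation. -/
lemma exists_perm (hD : IsLocallyTransitive D) :
    ∃ σ : Equiv.Perm V, ∀ v w, D.Adj v w → D.Adj v (σ v) ∧ (w ≠ σ v → D.Adj (σ v) w) := by
  classical
  have := Fintype.ofFinite V
  let S : Finset V := Finset.univ.filter fun v => ∃ w, D.Adj v w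
  have hf : ∀ v, ∃ s, v ∈ S → D.Adj v s ∧ ∀ w, D.Adj v w → w ≠ s → D.Adj s w := by
    intro v
    by_cases hv : v ∈ S
    · obtain ⟨s, hs⟩ := hD.exists_first (by simpa [S] using hv)
      exact ⟨s, fun _ => hs⟩
    · exact ⟨v, fun h => absurd h hv⟩
  choose f hf using hf
  have hinj : InjOn f S := by
    intro u hu v hv huv
    by_contra hne
    have h1 := hf u hu
    have h2 := hf v hv
    -- If `u → v`, then the first out-neighbour of `u` precedes `v`, yet it comes after `v`.
    have aux : ∀ {u v s : V}, D.Adj v s → (∀ w, D.Adj u w → w ≠ s → D.Adj s w) →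
        ¬ D.Adj u v := by
      intro u v s h1 h2 h3
      have hvs : v ≠ s := by
        rintro rfl
        exact hD.asymm _ _ h1 h1
      exact hD.asymm _ _ h1 (h2 v h3 hvs)
    rcases hD.inAdj u (f u) v h1.1 (huv ▸ h2.1) hne with h3 | h3
    · exact aux (huv ▸ h2.1) h1.2 h3
    · exact aux (huv ▸ h1.1) h2.2 h3
  obtain ⟨g, hg⟩ := Set.MapsTo.exists_equiv_extend_of_card_eq (s := (S : Set V)) (f := f)
    (t := Finset.univ) (by simp) (by intro; simp) hinj
  refine ⟨g.trans (Equiv.subtypeUnivEquiv (by simp)), fun v w hvw => ?_⟩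
  have hv : v ∈ S := by simpa [S] using ⟨w, hvw⟩
  have hgv : (g.trans (Equiv.subtypeUnivEquiv (by simp)) : Equiv.Perm V) v = f v := hg v hv
  rw [hgv]
  exact ⟨(hf v hv).1, (hf v hv).2 w hvw⟩

variable {σ : Equiv.Perm V}

/-- Iterating `σ` from `v`, the heads of the arcs of `v` are met before any other vertex. The
induction runs over a vertex `x` between `v` and `w`; the vertices between `x` and `w` become
fewer. -/
lemma exists_pow_aux (hD : IsLocallyTransitive D)
    (hσ : ∀ v w, D.Adj v w → D.Adj v (σ v) ∧ (w ≠ σ v → D.Adj (σ v) w)) {v w : V}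
    (hvw : D.Adj v w) (N : ℕ) : ∀ x, ({y | D.Adj x y ∧ D.Adj y w} : Set V).ncard = N →
      (x = v ∨ D.Adj v x) → D.Adj x w →
      ∃ k, 1 ≤ k ∧ w = (σ ^ k) x ∧ ∀ l, 1 ≤ l → l ≤ k → D.Adj v ((σ ^ l) x) := by
  induction N using Nat.strong_induction_on with
  | _ N ih =>
  intro x hN hvx hxw
  by_cases hw : w = σ x
  · refine ⟨1, le_rfl, by simpa using hw, fun l h1 h2 => ?_⟩
    obtain rfl : l = 1 := le_antisymm h2 h1
    simpa [← hw] using hvw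
  obtain ⟨h1, h2⟩ := hσ x w hxw
  have h2 := h2 hw
  have hvs : D.Adj v (σ x) := by
    rcases hvx with rfl | hvx
    · exact h1
    · have hne : v ≠ σ x := by
        intro h
        rw [← h] at h1
        exact hD.asymm _ _ h1 hvx
      exact (hD.inAdj v w (σ x) hvw h2 hne).resolve_right (hD.noTriangle _ _ _ hvx h1)
  obtain ⟨k, hk, hk', hk''⟩ := ih _ (by
    rw [← hN]
    refine Set.ncard_lt_ncard ?_ (Set.toFinite _)
    refine ⟨?_, fun hsub => hD.asymm _ _ (hsub ⟨h1, h2⟩).1 (hsub ⟨h1, h2⟩).1⟩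
    rintro y ⟨hy1, hy2⟩
    have hne : x ≠ y := by
      rintro rfl
      exact hD.asymm _ _ h1 hy1
    exact ⟨(hD.inAdj x w y hxw hy2 hne).resolve_right (hD.noTriangle _ _ _ h1 hy1), hy2⟩)
    (σ x) rfl (Or.inr hvs) h2
  refine ⟨k + 1, by omega, by rw [pow_succ]; exact hk', fun l hl hl' => ?_⟩
  obtain ⟨l, rfl⟩ : ∃ j, l = j + 1 := ⟨l - 1, by omega⟩
  rcases Nat.eq_zero_or_pos l with rfl | hl0
  · simpa using hvs
  · rw [pow_succ]; exact hk'' l hl0 (by omega)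

end IsLocallyTransitive

/-- A round enumeration of `D`: a cyclic permutation `σ` of the vertices such that the heads of
the arcs of `v` are the next `d v` vertices after `v`. By the last
clause, the arcs of `σ v` reach at least as far as those of `v`. -/
structure IsRound {V : Type*} (D : Digraph V) (σ : Equiv.Perm V) (d : V → ℕ) : Prop where
  isCycleOn : σ.IsCycleOn univ
  adj_iff : ∀ v w, D.Adj v w ↔ ∃ k, 1 ≤ k ∧ k ≤ d v ∧ w = (σ ^ k) v
  lt_card : ∀ v, d v < Nat.card V
  le_succ : ∀ v, d v ≤ d (σ v) + 1

lemma sameCycle_of_preconnected {V : Type*} {G : SimpleGraph V} (hG : G.Preconnected)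
    {σ : Equiv.Perm V} (h : ∀ u v, G.Adj u v → σ.SameCycle u v) (u v : V) : σ.SameCycle u v := by
  obtain ⟨p⟩ := hG u v
  induction p with
  | nil => exact Equiv.Perm.SameCycle.refl _ _
  | cons huv _ ih => exact (h _ _ huv).trans ih

theorem IsLocallyTransitive.exists_isRound {V : Type*} [Finite V] {G : SimpleGraph V}
    {D : Digraph V} (hG : G.Preconnected) (hGD : IsOrientation G D) (hD : IsLocallyTransitive D) :
    ∃ σ d, IsRound D σ d := by
  classical
  have := Fintype.ofFinite V
  obtain ⟨σ, hσ⟩ := hD.exists_perm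
  have hpow : ∀ {v w}, D.Adj v w →
      ∃ k, 1 ≤ k ∧ w = (σ ^ k) v ∧ ∀ l, 1 ≤ l → l ≤ k → D.Adj v ((σ ^ l) v) :=
    fun {v w} hvw => hD.exists_pow_aux hσ hvw _ v rfl (Or.inl rfl) hvw
  have hsame : ∀ u v, σ.SameCycle u v := by
    refine sameCycle_of_preconnected hG fun u v huv => ?_
    rcases (hGD.adj_iff u v).1 huv with h | h
    · obtain ⟨k, -, hk, -⟩ := hpow h
      exact ⟨k, by rw [zpow_natCast, ← hk]⟩
    · obtain ⟨k, -, hk, -⟩ := hpow h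
      exact Equiv.Perm.SameCycle.symm ⟨k, by rw [zpow_natCast, ← hk]⟩
  have hcyc : σ.IsCycleOn univ := ⟨σ.bijective.bijOn_univ, fun u _ v _ => hsame u v⟩
  have hcyc' : σ.IsCycleOn (Finset.univ : Finset V) := by simpa using hcyc
  have hper : ∀ (v : V) (k : ℕ), (σ ^ k) v = v ↔ Nat.card V ∣ k := by
    intro v k
    rw [hcyc'.pow_apply_eq (Finset.mem_univ v), Finset.card_univ, Nat.card_eq_fintype_card]
  let P : V → ℕ → Prop := fun v k => ∀ l, 1 ≤ l → l ≤ k → D.Adj v ((σ ^ l) v)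
  have hcard : ∀ v : V, 1 ≤ Nat.card V := fun v => by
    have : Nonempty V := ⟨v⟩
    exact Nat.card_pos
  have hlt : ∀ v k, P v k → k < Nat.card V := by
    intro v k hk
    by_contra! hc
    have h1 := hk _ (hcard v) hc
    rw [(hper v _).2 dvd_rfl] at h1
    exact hD.asymm _ _ h1 h1
  let d : V → ℕ := fun v => Nat.findGreatest (P v) (Nat.card V)
  have hd : ∀ v, P v (d v) := fun v =>
    Nat.findGreatest_spec (P := P v) (Nat.zero_le _) (by intro l h1 h2; omega)
  have hle : ∀ v k, P v k → k ≤ d v := fun v k hk => Nat.le_findGreatest (hlt v k hk).le hk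
  refine ⟨σ, d, hcyc, fun v w => ⟨fun h => ?_, ?_⟩, fun v => hlt v _ (hd v), fun v => ?_⟩
  · obtain ⟨k, h1, h2, h3⟩ := hpow h
    exact ⟨k, h1, hle v k h3, h2⟩
  · rintro ⟨k, h1, h2, rfl⟩
    exact hd v k h1 h2
  · suffices h : P (σ v) (d v - 1) by
      have := hle _ _ h
      omega
    intro l h1 h2
    have h3 : D.Adj v ((σ ^ l) (σ v)) := by
      have := hd v (l + 1) (by omega) (by omega)
      rwa [pow_succ] at this
    refine (hσ v _ h3).2 fun h => ?_
    have h4 := Nat.le_of_dvd (by omega) ((hper _ _).1 h)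
    have h5 := hlt v _ (hd v)
    omega

/-! ### From a round enumeration to a proper Helly circular-arc model -/

namespace IsRound

variable {V : Type*} {D : Digraph V} {σ : Equiv.Perm V} {d : V → ℕ}

/-- On the circle of length `n = Nat.card V`, the vertex at position `i` gets the arc from `i`
to `i + d + (n - d) / (2 n)`. The last summand is less than `1`; it makes the final points
strictly increasing in `i`. -/
noncomputable def arcEnd (σ : Equiv.Perm V) (d : V → ℕ) (r : V) (i : ℤ) : ℝ :=
  i + d ((σ ^ i) r) + (Nat.card V - d ((σ ^ i) r)) / (2 * Nat.card V)

/-- The arc of the vertex at position `i` after `r`, on the circle scaled to length `1`. -/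
noncomputable def roundArc (σ : Equiv.Perm V) (d : V → ℕ) (r : V) (i : ℤ) : Set UnitAddCircle :=
  arc (i / Nat.card V) (arcEnd σ d r i / Nat.card V)

variable [Finite V]

lemma zpow_eq_iff (h : IsRound D σ d) (r : V) (i j : ℤ) :
    (σ ^ i) r = (σ ^ j) r ↔ ∃ m : ℤ, i = j + m * Nat.card V := by
  have := Fintype.ofFinite V
  have hcyc : σ.IsCycleOn (Finset.univ : Finset V) := by simpa using h.isCycleOn
  rw [hcyc.zpow_apply_eq_zpow_apply (Finset.mem_univ r), Int.modEq_iff_dvd, Finset.card_univ,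
    ← Nat.card_eq_fintype_card]
  constructor
  · rintro ⟨m, hm⟩
    exact ⟨-m, by linarith⟩
  · rintro ⟨m, hm⟩
    exact ⟨-m, by linarith⟩

lemma card_pos (_h : IsRound D σ d) (r : V) : (0 : ℝ) < Nat.card V := by
  have : Nonempty V := ⟨r⟩
  exact_mod_cast Nat.card_pos

lemma roundArc_add (h : IsRound D σ d) (r : V) (i m : ℤ) :
    roundArc σ d r (i + m * Nat.card V) = roundArc σ d r i := by
  have hn := h.card_pos r
  have h1 := (h.zpow_eq_iff r (i + m * Nat.card V) i).2 ⟨m, rfl⟩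
  rw [roundArc, roundArc, ← arc_add_int (i / Nat.card V) _ m, arcEnd, arcEnd, h1]
  congr 1
  · push_cast; field_simp
  · push_cast; field_simp; ring

lemma le_arcEnd (h : IsRound D σ d) (r : V) (i : ℤ) :
    (i + d ((σ ^ i) r) : ℝ) < arcEnd σ d r i := by
  have hn := h.card_pos r
  have hd : (d ((σ ^ i) r) : ℝ) < Nat.card V := by exact_mod_cast h.lt_card _
  have : (0 : ℝ) < (Nat.card V - d ((σ ^ i) r)) / (2 * Nat.card V) := by
    apply div_pos <;> linarith
  rw [arcEnd]
  linarith

lemma arcEnd_lt (h : IsRound D σ d) (r : V) (i : ℤ) :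
    arcEnd σ d r i < i + d ((σ ^ i) r) + 1 := by
  have hn := h.card_pos r
  have : ((Nat.card V - d ((σ ^ i) r)) / (2 * Nat.card V) : ℝ) < 1 := by
    rw [div_lt_one (by linarith)]
    have : (0 : ℝ) ≤ d ((σ ^ i) r) := by positivity
    linarith
  rw [arcEnd]
  linarith

lemma arcEnd_lt_add_card (h : IsRound D σ d) (r : V) (i : ℤ) :
    arcEnd σ d r i < i + Nat.card V := by
  have h1 := h.arcEnd_lt r i
  have hd : (d ((σ ^ i) r) + 1 : ℝ) ≤ Nat.card V := by exact_mod_cast h.lt_card _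
  linarith

lemma arcEnd_strictMono (h : IsRound D σ d) (r : V) : StrictMono (arcEnd σ d r) := by
  refine strictMono_int_of_lt_succ fun i => ?_
  have hn := h.card_pos r
  have hs : (σ ^ (i + 1)) r = σ ((σ ^ i) r) := by rw [add_comm, zpow_add]; simp
  have h1 : (d ((σ ^ i) r) : ℝ) ≤ d (σ ((σ ^ i) r)) + 1 := by exact_mod_cast h.le_succ _
  have hn1 : (1 : ℝ) ≤ Nat.card V := by
    have : 0 < Nat.card V := by exact_mod_cast hn
    exact_mod_cast this
  rw [arcEnd, arcEnd, hs]
  set x : ℝ := (d ((σ ^ i) r) : ℝ)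
  set y : ℝ := (d (σ ((σ ^ i) r)) : ℝ)
  set n : ℝ := (Nat.card V : ℝ)
  have e : ∀ z : ℝ, z + (n - z) / (2 * n) = z * (1 - 1 / (2 * n)) + 1 / 2 := by
    intro z; field_simp; ring
  have h2 : 0 < 1 / (2 * n) := by positivity
  have h3 : 1 / (2 * n) ≤ 1 / 2 := by
    apply one_div_le_one_div_of_le <;> linarith
  have h4 : x * (1 - 1 / (2 * n)) ≤ (y + 1) * (1 - 1 / (2 * n)) :=
    mul_le_mul_of_nonneg_right h1 (by linarith)
  have := e x
  have := e y
  push_cast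
  linarith

/-- The arc of a vertex contains exactly the positions of the vertex and of the heads of its
arcs. -/
lemma start_mem_iff (h : IsRound D σ d) (r : V) (i j : ℤ) :
    ((j / Nat.card V : ℝ) : UnitAddCircle) ∈ roundArc σ d r i ↔
      (σ ^ j) r = (σ ^ i) r ∨ D.Adj ((σ ^ i) r) ((σ ^ j) r) := by
  have hn := h.card_pos r
  have e : ∀ m : ℤ, (j / Nat.card V + m : ℝ) = ((j + m * Nat.card V : ℤ) : ℝ) / Nat.card V := by
    intro m; push_cast; field_simp
  rw [roundArc, coe_mem_arc]
  constructor
  · rintro ⟨m, h1, h2⟩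
    rw [e, div_le_div_iff_of_pos_right hn] at h1 h2
    rw [← (h.zpow_eq_iff r (j + m * Nat.card V) j).2 ⟨m, rfl⟩]
    generalize j + m * Nat.card V = k at *
    have h3 : i ≤ k := by exact_mod_cast h1
    have h4 : k < i + d ((σ ^ i) r) + 1 := by exact_mod_cast h2.trans_lt (h.arcEnd_lt r i)
    obtain ⟨l, rfl⟩ := Int.le.dest h3
    rcases Nat.eq_zero_or_pos l with rfl | hl
    · simp
    · refine Or.inr ((h.adj_iff _ _).2 ⟨l, hl, by omega, ?_⟩)
      rw [add_comm, zpow_add, zpow_natCast]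
      rfl
  · intro hj
    obtain ⟨l, hl, hl'⟩ : ∃ l : ℕ, l ≤ d ((σ ^ i) r) ∧ (σ ^ j) r = (σ ^ (i + l)) r := by
      rcases hj with hj | hj
      · exact ⟨0, by omega, by simpa using hj⟩
      · obtain ⟨l, -, h2, h3⟩ := (h.adj_iff _ _).1 hj
        refine ⟨l, h2, ?_⟩
        rw [h3, add_comm, zpow_add, zpow_natCast]
        rfl
    obtain ⟨m, rfl⟩ := (h.zpow_eq_iff r _ _).1 hl'
    have h1 := h.le_arcEnd r i
    have h2 : (l : ℝ) ≤ d ((σ ^ i) r) := by exact_mod_cast hl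
    refine ⟨-m, ?_, ?_⟩ <;> rw [e, div_le_div_iff_of_pos_right hn] <;> push_cast
    · have : (0 : ℝ) ≤ l := by positivity
      linarith
    · linarith

lemma not_roundArc_subset (h : IsRound D σ d) (r : V) {i j : ℤ} (hij : (σ ^ i) r ≠ (σ ^ j) r) :
    ¬ roundArc σ d r i ⊆ roundArc σ d r j := by
  have hn := h.card_pos r
  intro hsub
  have h0 : ((i / Nat.card V : ℝ) : UnitAddCircle) ∈ roundArc σ d r i :=
    (h.start_mem_iff r i i).2 (Or.inl rfl)
  -- Shift the lift of the first arc so that it starts inside the second one.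
  obtain ⟨m, h1, h2⟩ := coe_mem_arc.1 (hsub h0)
  have e : (i / Nat.card V + m : ℝ) = ((i + m * Nat.card V : ℤ) : ℝ) / Nat.card V := by
    push_cast; field_simp
  rw [← h.roundArc_add r i m] at hsub
  rw [← (h.zpow_eq_iff r (i + m * Nat.card V) i).2 ⟨m, rfl⟩] at hij
  rw [e] at h1 h2
  generalize i + m * Nat.card V = k at *
  have h1' := h1
  rw [div_le_div_iff_of_pos_right hn] at h1'
  have hjk : j < k := lt_of_le_of_ne (by exact_mod_cast h1') (by rintro rfl; exact hij rfl)
  refine not_arc_subset_arc h2 ?_ ?_ hsub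
  · exact (div_lt_div_iff_of_pos_right hn).2 (h.arcEnd_strictMono r hjk)
  · rw [div_add_one hn.ne', div_lt_div_iff_of_pos_right hn]
    exact h.arcEnd_lt_add_card r j

end IsRound

theorem IsRound.isProperHellyCircularArc {V : Type*} [Finite V] {G : SimpleGraph V}
    {D : Digraph V} (hGD : IsOrientation G D) (hD : IsLocallyTransitive D) {σ : Equiv.Perm V}
    {d : V → ℕ} (h : IsRound D σ d) : IsProperHellyCircularArc G := by
  rcases isEmpty_or_nonempty V with hV | ⟨⟨r⟩⟩
  · exact ⟨fun _ => ∅, ⟨fun v => hV.elim v, fun v => hV.elim v⟩, fun v => hV.elim v,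
      fun S hS => hV.elim hS.some⟩
  have hn := h.card_pos r
  have hpos : ∀ v, ∃ i : ℤ, (σ ^ i) r = v := fun v => h.isCycleOn.2 (mem_univ r) (mem_univ v)
  choose p hp using hpos
  have hmem : ∀ u v, ((p v / Nat.card V : ℝ) : UnitAddCircle) ∈ roundArc σ d r (p u) ↔
      v = u ∨ D.Adj u v := fun u v => by rw [h.start_mem_iff, hp, hp]
  have hinter : ∀ u v, (roundArc σ d r (p u) ∩ roundArc σ d r (p v)).Nonempty ↔
      u = v ∨ D.Adj u v ∨ D.Adj v u := by
    intro u v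
    constructor
    · intro huv
      rcases start_mem_or_of_inter huv with h1 | h1
      · rcases (hmem v u).1 h1 with h2 | h2 <;> simp [h2]
      · rcases (hmem u v).1 h1 with h2 | h2 <;> simp [h2]
    · rintro (rfl | h1 | h1)
      · exact ⟨_, (hmem u u).2 (Or.inl rfl), (hmem u u).2 (Or.inl rfl)⟩
      · exact ⟨_, (hmem u v).2 (Or.inr h1), (hmem v v).2 (Or.inl rfl)⟩
      · exact ⟨_, (hmem u u).2 (Or.inl rfl), (hmem v u).2 (Or.inr h1)⟩
  refine ⟨fun v => roundArc σ d r (p v), ⟨fun v => ?_, fun u v hne => ?_⟩, fun u v hne => ?_,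
    fun S hS hSS => ?_⟩
  · refine ⟨_, _, ?_, ?_, rfl⟩
    · rw [div_lt_div_iff_of_pos_right hn]
      exact lt_of_le_of_lt (le_add_of_nonneg_right (by positivity)) (h.le_arcEnd r (p v))
    · rw [div_add_one hn.ne', div_lt_div_iff_of_pos_right hn]
      exact h.arcEnd_lt_add_card r _
  · rw [hGD.adj_iff, hinter]
    simp [hne]
  · exact h.not_roundArc_subset r (by rwa [hp, hp])
  · -- The initial point of the sink of a clique lies on all arcs of the clique.
    obtain ⟨v, hv, hvS⟩ := hD.exists_sink hS fun u hu v hv hne =>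
      ((hinter u v).1 (hSS u hu v hv)).resolve_left hne
    refine ⟨_, mem_iInter₂.2 fun u hu => (hmem u v).2 ?_⟩
    rcases eq_or_ne u v with rfl | hne
    · exact Or.inl rfl
    · exact Or.inr (hvS u hu hne)

end OrientedGraphs

theorem mainTheorem4 {V : Type*} [Finite V] (G : SimpleGraph V) :
    (G.Preconnected →
      (OrientedGraphs.AdmitsFreeOrientation
          {OrientedGraphs.orientedB1, OrientedGraphs.orientedB2,
            OrientedGraphs.directedTriangle} G ↔
        OrientedGraphs.IsProperHellyCircularArc G)) ∧
    (OrientedGraphs.IsProperHellyCircularArc G →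
      OrientedGraphs.AdmitsFreeOrientation
        {OrientedGraphs.orientedB1, OrientedGraphs.orientedB2,
          OrientedGraphs.directedTriangle} G) := by
  refine ⟨fun hG => ⟨fun h => ?_, fun h => ?_⟩, fun h => ?_⟩
  · obtain ⟨D, hGD, hD⟩ := OrientedGraphs.admitsFreeOrientation_iff.1 h
    obtain ⟨σ, d, hσ⟩ := hD.exists_isRound hG hGD
    exact hσ.isProperHellyCircularArc hGD hD
  · exact OrientedGraphs.admitsFreeOrientation_iff.2 h.exists_isLocallyTransitive
  · exact OrientedGraphs.admitsFreeOrientation_iff.2 h.exists_isLocallyTransitive
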